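/- Fix an infinite set $\mathcal V$ of variables and a non-empty set $A$ of atoms. $\lambda$-terms are considered up to renaming of bound variables ($\alpha$-equivalence); a named representative *respects the variable convention* if each variable is bound at most once in it. **The head Krivine machine.** A closure is a pair $(t,e)$ of a (named) $\lambda$-term $t$ and a finite partial map $e$ from variables to closures (an environment); a state is a non-empty finite sequence $c.\pi$ of closures ($\varepsilon$ is the empty sequence). For a closure $c=(t,e)$, let $\overline c=t[e]$ be the $\lambda$-term obtained by substituting (recursively) in $t$ the terms $\overline{e(x)}$ for the variables $x\in\mathrm{dom}(e)$. The partial map $\succ_h$ is given by - $(x,e).\pi\succ_h e(x).\pi$ if $x\in\mathrm{dom}(e)$; - $((x,e),c_1,\dots,c_q)\succ_h (x)\overline{c_1}\dots\overline{c_q}$ if $x\notin\mathrm{dom}(e)$; - $(\lambda x.u,e).(c.\pi)\succ_h (u,\{(x,c)\}\cup e).\pi$; - $(\lambda x.u,e).\varepsilon\succ_h\lambda x.((u,e).\varepsilon)$; - $((v)u,e).\pi\succ_h (v,e).((u,e).\pi)$; - $\lambda y.k\succ_h\lambda y.k'$ if $k\succ_h k'$; and it is undefined on the terms $(x)t_1\dots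 t_p$. Let $l_h(k)\in\mathbb N\cup\{\infty\}$ be the number of steps of $\succ_h$ from $k$ to an object on which $\succ_h$ is undefined, and $\infty$ if no such object is reached. **System $R$.** Types form the least set $D=A\mathbin{\dot\cup}(\mathcal M_{\rm fin}(D)\times D)$, where $\mathcal M_{\rm fin}(D)$ is the set of finite multisets over $D$. Contexts are functions $\mathcal V\to\mathcal M_{\rm fin}(D)$ with value $[\,]$ on all but finitely many variables, added pointwise. The rules are: $x:[\alpha]\vdash x:\alpha$; from $\Gamma,x:a\vdash v:\alpha$ (with $\Gamma(x)=[\,]$) infer $\Gamma\vdash\lambda x.v:(a,\alpha)$; and, for every $n\ge 0$, from $\Gamma_0\vdash v:([\alpha_1,\dots,\alpha_n],\alpha)$ and $\Gamma_i\vdash u:\alpha_i$ ($1\le i\le n$) infer $\Gamma_0+\Gamma_1+\dots+\Gamma_n\vdash (v)u:\alpha$. The size $|\Pi|$ of a derivation $\Pi$ is the number of its nodes; $\Delta(t)$ is the set of all derivations of judgements $\Gamma\vdash t:\alpha$, for all contexts $\Gamma$ and types $\alpha$. **Theorem.** Every $\lambda$-term $t$ is $\alpha$-equivalent to a term that respects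 the variable convention, and for every such representative $u$ of $t$, $$l_h\big((u,\emptyset).\varepsilon\big)=\inf\{\,|\Pi| : \Pi\in\Delta(t)\,\}\in\mathbb N\cup\{\infty\},$$ with $\inf\emptyset=\infty$. If $t$ is not head normalizable (that is, its head reduction reaches no head normal form), then both sides are $\infty$. -/

import Mathlib

namespace HeadKrivine

universe u v

/-! ### Terms of the pure λ-calculus with named variables -/

/-- λ-terms over the set `V` of variables (before identification up to renaming of bound
variables). -/
inductive Term (V : Type u) : Type u
  | var (x : V) : Term V
  | app (t s : Term V) : Term V
  | lam (x : V) (t : Term V) : Term V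

namespace Term

variable {V : Type u}

/-- All variables occurring in a term: free, bound or binding. -/
def vars [DecidableEq V] : Term V → Finset V
  | var x => {x}
  | app t s => t.vars ∪ s.vars
  | lam x t => insert x t.vars

/-- Free variables. -/
def fv [DecidableEq V] : Term V → Finset V
  | var x => {x}
  | app t s => t.fv ∪ s.fv
  | lam x t => t.fv.erase x

/-- The variables bound in a term, each counted as many times as it is bound. -/
def bound : Term V → Multiset V
  | var _ => 0
  | app t s => t.bound + s.bound
  | lam x t => x ::ₘ t.bound

/-- A term respects the variable convention if any variable is bound at most once in it. -/
def RespectsConvention (t : Term V) : Prop :=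
  t.bound.Nodup

/-- Apply `π` to all variables of a term, the binding ones included. -/
def rename (π : V → V) : Term V → Term V
  | var x => var (π x)
  | app t s => app (t.rename π) (s.rename π)
  | lam x t => lam (π x) (t.rename π)

/-- α-equivalence: equality up to renaming of bound variables. -/
inductive AlphaEq [DecidableEq V] : Term V → Term V → Prop
  | var (x : V) : AlphaEq (var x) (var x)
  | app {t t' s s' : Term V} : AlphaEq t t' → AlphaEq s s' → AlphaEq (app t s) (app t' s')
  | lam {x y z : V} {t s : Term V} (hx : z ≠ x) (hy : z ≠ y) (ht : z ∉ t.vars) (hs : z ∉ s.vars) :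
      AlphaEq (t.rename (Equiv.swap x z)) (s.rename (Equiv.swap y z)) →
      AlphaEq (lam x t) (lam y s)

section Substitution

variable [DecidableEq V] [Infinite V]

/-- A variable outside the finite set `S`: `x` itself if possible. -/
noncomputable def pick (x : V) (S : Finset V) : V :=
  if x ∈ S then Classical.choose (Infinite.exists_notMem_finset S) else x

/-- Simultaneous capture-avoiding substitution. Under a binder, the bound variable is replaced
by one that is not free in any of the substituted terms. -/
noncomputable def subst : Term V → (V → Term V) → Term V
  | var x, σ => σ x
  | app t s, σ => app (t.subst σ) (s.subst σ)
  | lam x t, σ =>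
      let z := pick x ((t.fv.erase x).biUnion fun y => (σ y).fv)
      lam z (t.subst (Function.update σ x (var z)))

/-- `t[s/x]`. -/
noncomputable def subst1 (t : Term V) (x : V) (s : Term V) : Term V :=
  t.subst (Function.update var x s)

/-- One step of head reduction in `(λx.t) s s₁ … s_p`, at the redex `(λx.t) s`. -/
inductive WeakHeadRed : Term V → Term V → Prop
  | beta (x : V) (t s : Term V) : WeakHeadRed (app (lam x t) s) (t.subst1 x s)
  | app {t t' : Term V} (s : Term V) : WeakHeadRed t t' → WeakHeadRed (app t s) (app t' s)

/-- One step of head reduction: `λx₁…x_m.(λx.t) s s₁ … s_p → λx₁…x_m. t[s/x] s₁ … s_p`. -/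
inductive HeadRed : Term V → Term V → Prop
  | weak {t t' : Term V} : WeakHeadRed t t' → HeadRed t t'
  | lam (x : V) {t t' : Term V} : HeadRed t t' → HeadRed (lam x t) (lam x t')

end Substitution

/-- Terms of the form `x t₁ … t_p`. -/
inductive IsNeutral : Term V → Prop
  | var (x : V) : IsNeutral (var x)
  | app {t : Term V} (s : Term V) : IsNeutral t → IsNeutral (app t s)

/-- Head normal forms: terms of the form `λx₁…x_m. x t₁ … t_p`. -/
inductive IsHNF : Term V → Prop
  | neutral {t : Term V} : IsNeutral t → IsHNF t
  | lam (x : V) {t : Term V} : IsHNF t → IsHNF (lam x t)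

/-- A term is head normalizable if its head reduction reaches a head normal form. -/
def HeadNormalizable [DecidableEq V] [Infinite V] (t : Term V) : Prop :=
  ∃ t', Relation.ReflTransGen HeadRed t t' ∧ IsHNF t'

end Term

/-! ### The head Krivine machine -/

/-- Closures `(t, e)`, where the environment `e` is a finite partial map from variables to
closures, given by its domain `dom` and its values `val`. -/
inductive Clos (V : Type u) : Type u
  | mk (t : Term V) (dom : Finset V) (val : {x : V // x ∈ dom} → Clos V) : Clos V

namespace Clos

variable {V : Type u}

/-- The closure `(t, ∅)`. -/
def ofTerm (t : Term V) : Clos V :=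
  mk t ∅ fun x => absurd x.2 (Finset.notMem_empty x.1)

/-- The values of the environment `{(x, c)} ∪ e`, where `e` is given by `dom` and `val` (and
`x ∉ dom` for the states that respect the variable convention). -/
def extend [DecidableEq V] (dom : Finset V) (val : {x : V // x ∈ dom} → Clos V) (x : V)
    (c : Clos V) : {y : V // y ∈ insert x dom} → Clos V :=
  fun y => if h : y.1 = x then c else val ⟨y.1, Finset.mem_of_mem_insert_of_ne y.2 h⟩

/-- The λ-term `t[e]` denoted by the closure `(t, e)`. -/
noncomputable def toTerm [DecidableEq V] [Infinite V] : Clos V → Term V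
  | mk t dom val => t.subst fun x => if h : x ∈ dom then (val ⟨x, h⟩).toTerm else Term.var x

/-- A closure `(t, e)` respects the variable convention if `t` and all closures in `e` do, and no
variable of the domain of `e` is bound in `t`. -/
def RespectsConvention : Clos V → Prop
  | mk t dom val => t.RespectsConvention ∧ (∀ x ∈ dom, x ∉ t.bound) ∧
      ∀ x, (val x).RespectsConvention

end Clos

/-- States `c₀ . π`: non-empty stacks of closures. -/
structure State (V : Type u) : Type u where
  clos : Clos V
  stack : List (Clos V)

namespace State

variable {V : Type u}

/-- The state `(t, ∅) . ε`. -/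
def init (t : Term V) : State V := ⟨Clos.ofTerm t, []⟩

/-- A state respects the variable convention if all its closures do. -/
def RespectsConvention (s : State V) : Prop :=
  s.clos.RespectsConvention ∧ ∀ c ∈ s.stack, c.RespectsConvention

/-- The execution of states, a partial map. -/
def step [DecidableEq V] : State V → Option (State V)
  | ⟨.mk (.var x) dom val, π⟩ => if h : x ∈ dom then some ⟨val ⟨x, h⟩, π⟩ else none
  | ⟨.mk (.lam _ _) _ _, []⟩ => none
  | ⟨.mk (.lam x t) dom val, c :: π⟩ =>
      some ⟨.mk t (insert x dom) (Clos.extend dom val x c), π⟩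
  | ⟨.mk (.app t s) dom val, π⟩ => some ⟨.mk t dom val, .mk s dom val :: π⟩

/-- The states that respect the variable convention are closed under execution. -/
theorem RespectsConvention.step [DecidableEq V] {s s' : State V} (hs : s.RespectsConvention)
    (h : s.step = some s') : s'.RespectsConvention := by
  obtain ⟨⟨t, dom, val⟩, π⟩ := s
  obtain ⟨⟨ht, hb, hv⟩, hπ⟩ := hs
  cases t with
  | var x =>
    simp only [State.step] at h
    split at h
    · cases h
      exact ⟨hv _, hπ⟩
    · cases h
  | app t s =>
    cases h
    rw [Term.RespectsConvention, Term.bound, Multiset.nodup_add] at ht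
    simp only [Term.bound, Multiset.mem_add, not_or] at hb
    refine ⟨⟨ht.1, fun x hx => (hb x hx).1, hv⟩, ?_⟩
    intro c hc
    rcases List.mem_cons.1 hc with rfl | hc
    · exact ⟨ht.2.1, fun x hx => (hb x hx).2, hv⟩
    · exact hπ c hc
  | lam x t =>
    cases π with
    | nil => cases h
    | cons c π =>
      cases h
      rw [Term.RespectsConvention, Term.bound, Multiset.nodup_cons] at ht
      simp only [Term.bound, Multiset.mem_cons, not_or] at hb
      refine ⟨⟨ht.2, ?_, ?_⟩, fun c' hc' => hπ c' (List.mem_cons_of_mem _ hc')⟩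
      · intro y hy
        rcases Finset.mem_insert.1 hy with rfl | hy
        · exact ht.1
        · exact (hb y hy).2
      · intro y
        unfold Clos.extend
        split
        · exact hπ c List.mem_cons_self
        · exact hv _

end State

/-- The objects reduced by the machine: states, terms `x t₁ … t_p` whose arguments are λ-terms or
again such objects, and abstractions of such objects. -/
inductive Conf (V : Type u) : Type u
  | state (s : State V) : Conf V
  | head (x : V) (args : List (Term V ⊕ Conf V)) : Conf V
  | lam (y : V) (k : Conf V) : Conf V

namespace Conf

variable {V : Type u} [DecidableEq V] [Infinite V]

/-- The head Krivine machine, a partial map: states are executed; when this is not possible,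
`((x, e), c₁, …, c_q)` with `x` outside the domain of `e` goes to `x c̄₁ … c̄_q`, where `c̄ᵢ` is
the λ-term denoted by `cᵢ`, and `(λx.t, e) . ε` goes to `λx.((t, e) . ε)`. -/
noncomputable def step : Conf V → Option (Conf V)
  | state s =>
      match s.step with
      | some s' => some (state s')
      | none =>
        match s with
        | ⟨.mk (.var x) _ _, π⟩ => some (head x (π.map fun c => .inl c.toTerm))
        | ⟨.mk (.lam x t) dom val, []⟩ => some (lam x (state ⟨.mk t dom val, []⟩))
        | _ => none
  | head _ _ => none
  | lam y k => (step k).map (lam y)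

/-- `k.HaltsIn n`: the machine started at `k` reaches a Krivine normal form (where it is not
defined) after exactly `n` steps. -/
def HaltsIn : ℕ → Conf V → Prop
  | 0, k => k.step = none
  | n + 1, k => ∃ k', k.step = some k' ∧ HaltsIn n k'

/-- The machine is deterministic, so the number of steps is unique. -/
theorem HaltsIn.unique {n m : ℕ} {k : Conf V} (hn : k.HaltsIn n) (hm : k.HaltsIn m) : n = m := by
  induction n generalizing m k with
  | zero =>
    cases m with
    | zero => rfl
    | succ m =>
      obtain ⟨k', h, -⟩ := hm
      rw [show k.step = none from hn] at h
      cases h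
  | succ n ih =>
    obtain ⟨k', h, hn⟩ := hn
    cases m with
    | zero =>
      rw [show k.step = none from hm] at h
      cases h
    | succ m =>
      obtain ⟨k'', h', hm⟩ := hm
      rw [h] at h'
      cases h'
      rw [ih hn hm]

/-- The number `l_h(k)` of steps of the head Krivine machine from `k` to a Krivine normal form, and
`∞` if none is reached. -/
noncomputable def steps (k : Conf V) : ℕ∞ :=
  ⨅ (n : ℕ) (_ : k.HaltsIn n), (n : ℕ∞)

end Conf

/-! ### Types -/

/-- The functor `X ↦ A ⊎ (M_fin(X) × X)`. -/
def TyF (A : Type v) (X : Type v) : Type v := A ⊕ (Multiset X × X)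

/-- This functor is a quotient of a polynomial functor, hence has an initial algebra. -/
noncomputable instance TyF.instQPF (A : Type v) : QPF.{v, v} (TyF A) where
  map f := Sum.map id (Prod.map (Multiset.map f) f)
  P := ⟨A ⊕ ℕ, fun s => Sum.elim (fun _ => PEmpty) (fun n => ULift (Option (Fin n))) s⟩
  abs := fun {X} p =>
    match p with
    | ⟨.inl a, _⟩ => .inl a
    | ⟨.inr _, f⟩ => .inr ((List.ofFn fun i => f ⟨some i⟩ : List X), f ⟨none⟩)
  repr := fun {X} x =>
    match x with
    | .inl a => ⟨.inl a, PEmpty.elim⟩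
    | .inr (m, b) => ⟨.inr m.toList.length, fun o => o.down.elim b m.toList.get⟩
  abs_repr := by
    intro X x
    rcases x with a | ⟨m, b⟩
    · rfl
    · have h : (List.ofFn fun i => m.toList.get i) = m.toList := List.ofFn_get _
      change Sum.inr (((List.ofFn fun i => m.toList.get i : List X) : Multiset X), b) =
        Sum.inr (m, b)
      rw [h, Multiset.coe_toList]
  abs_map := by
    intro X Y f p
    rcases p with ⟨a | n, g⟩
    · rfl
    · change Sum.inr (((List.ofFn fun i => f (g ⟨some i⟩) : List Y) : Multiset Y), f (g ⟨none⟩)) =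
        Sum.inr (Multiset.map f ((List.ofFn fun i => g ⟨some i⟩ : List X) : Multiset X), f (g ⟨none⟩))
      rw [Multiset.map_coe, List.map_ofFn]
      rfl

/-- The set `D` of types over the set `A` of atoms: the least set such that
`D = A ⊎ (M_fin(D) × D)`. -/
def Ty (A : Type v) : Type v := QPF.Fix (TyF A)

namespace Ty

variable {A : Type v}

/-- An atom, as a type. -/
noncomputable def atom (a : A) : Ty A :=
  QPF.Fix.mk (F := TyF A) (Sum.inl a)

/-- The type `(a, α)`. -/
noncomputable def arrow (a : Multiset (Ty A)) (α : Ty A) : Ty A :=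
  QPF.Fix.mk (F := TyF A) (Sum.inr (a, α))

/-- The decomposition `D = A ⊎ (M_fin(D) × D)`. -/
noncomputable def equivSum (A : Type v) : Ty A ≃ A ⊕ (Multiset (Ty A) × Ty A) where
  toFun := QPF.Fix.dest (F := TyF A)
  invFun := QPF.Fix.mk (F := TyF A)
  left_inv := QPF.Fix.mk_dest (F := TyF A)
  right_inv := QPF.Fix.dest_mk (F := TyF A)

@[simp] theorem equivSum_atom (a : A) : equivSum A (atom a) = Sum.inl a :=
  (equivSum A).right_inv (Sum.inl a)

@[simp] theorem equivSum_arrow (a : Multiset (Ty A)) (α : Ty A) :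
    equivSum A (arrow a α) = Sum.inr (a, α) :=
  (equivSum A).right_inv (Sum.inr (a, α))

/-- Induction on types. -/
theorem induction {p : Ty A → Prop} (atom : ∀ a, p (atom a))
    (arrow : ∀ a α, (∀ β ∈ a, p β) → p α → p (arrow a α)) (α : Ty A) : p α := by
  refine QPF.Fix.ind (F := TyF A) p ?_ α
  rintro x ⟨u, rfl⟩
  rcases u with a | ⟨m, b⟩
  · exact atom a
  · refine arrow (m.map Subtype.val) b.1 ?_ b.2
    intro β hβ
    obtain ⟨c, -, rfl⟩ := Multiset.mem_map.1 hβ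
    exact c.2

end Ty

/-! ### System R -/

/-- Contexts: functions from variables to finite multisets of types that are empty on all but
finitely many variables, with pointwise addition. -/
abbrev Ctx (V : Type u) (A : Type v) : Type (max u v) := V →₀ Multiset (Ty A)

/-- `Derivation Γ t α` is the set of derivations of `Γ ⊢ t : α` in System R. In the second rule,
`Γ, x : a` is the context that maps `x` to `a` and is `Γ` elsewhere, where `Γ x` is empty. -/
inductive Derivation {V : Type u} {A : Type v} : Ctx V A → Term V → Ty A → Type (max u v)
  | var (x : V) (α : Ty A) : Derivation (Finsupp.single x {α}) (.var x) α
  | lam {Γ : Ctx V A} {x : V} {a : Multiset (Ty A)} {t : Term V} {α : Ty A} (hx : Γ x = 0) :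
      Derivation (Γ + Finsupp.single x a) t α → Derivation Γ (.lam x t) (Ty.arrow a α)
  | app {Γ₀ : Ctx V A} {n : ℕ} {Γ : Fin n → Ctx V A} {α : Fin n → Ty A} {β : Ty A}
      {t s : Term V} :
      Derivation Γ₀ t (Ty.arrow (Multiset.ofList (List.ofFn α)) β) →
      (∀ i, Derivation (Γ i) s (α i)) →
      Derivation (Γ₀ + ∑ i, Γ i) (.app t s) β

/-- The size of a derivation: the number of nodes of the tree. -/
noncomputable def Derivation.size {V : Type u} {A : Type v} {Γ : Ctx V A} {t : Term V} {α : Ty A} :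
    Derivation Γ t α → ℕ
  | .var _ _ => 1
  | .lam _ d => d.size + 1
  | .app d ds => d.size + ∑ i, (ds i).size + 1

/-- The infimum, in `ℕ ∪ {∞}`, of the sizes of all derivations of System R over the atoms `A` that
type the term `t`, with any context and any type; it is `∞` if there are none. -/
noncomputable def minSize {V : Type u} (A : Type v) (t : Term V) : ℕ∞ :=
  ⨅ (Γ : Ctx V A) (α : Ty A) (d : Derivation Γ t α), (d.size : ℕ∞)

end HeadKrivine

open HeadKrivine

/-! Sizes of typings are extended from terms to machine states in such a way that every step lowers
them by exactly one. A typing of a closure `(t, e)` consists of a derivation for `t` and, for each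
declaration `x : α` of its context with `x` in the domain of `e`, a typing of `e(x)` by `α`; all
sizes are added. A stack is typed against the argument types of the head closure. A machine step
then consumes one node: the axiom when a variable is looked up, the application node when an
argument is pushed, the abstraction node when one is popped or when the machine passes under a
binder (`State.typ_iff_of_step`, `State.typ_lam_nil`). The term `t[e]` plays no role.

Sizes of typings are positive, so a state with a typing of size `n` halts within `n` steps
(`State.Typ.exists_haltsIn`). Conversely, a state with a free head variable has a typing of size 1
in which every argument receives the empty multiset; going back along a halting run adds one per
step and yields a typing whose size is the length of the run (`State.typ_of_haltsIn`). Hence the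
length is the least size. Invariance under α-equivalence (`Typ.alphaEq`) carries this from the
representative to the given term.

For terms that are not head normalizable, a quantitative substitution lemma (`Typ.subst`) shows that
head reduction strictly decreases sizes, so that every typable term reaches a head normal form. -/

namespace HeadKrivine

universe u v

/-! ### Sums of families of elements related to a multiset -/

/-- `MRel P a m`: `m` is a sum of elements related by `P` to the elements of `a`. -/
def MRel {ι M : Type*} [AddCommMonoid M] (P : ι → M → Prop) (a : Multiset ι) (m : M) : Prop :=
  ∃ S, Multiset.Rel P a S ∧ S.sum = m

namespace MRel

variable {ι κ M N : Type*} [AddCommMonoid M] [AddCommMonoid N] {P : ι → M → Prop}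

@[simp] theorem zero_left {m : M} : MRel P 0 m ↔ m = 0 := by
  simp [MRel, Multiset.rel_zero_left, eq_comm]

theorem cons_left {i : ι} {a : Multiset ι} {m : M} :
    MRel P (i ::ₘ a) m ↔ ∃ p q, P i p ∧ MRel P a q ∧ m = p + q := by
  constructor
  · rintro ⟨S, hS, rfl⟩
    obtain ⟨p, T, hp, hT, rfl⟩ := Multiset.rel_cons_left.1 hS
    exact ⟨p, T.sum, hp, ⟨T, hT, rfl⟩, Multiset.sum_cons _ _⟩
  · rintro ⟨p, q, hp, ⟨S, hS, rfl⟩, rfl⟩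
    exact ⟨p ::ₘ S, hS.cons hp, Multiset.sum_cons _ _⟩

theorem add_left {a b : Multiset ι} {m : M} :
    MRel P (a + b) m ↔ ∃ p q, MRel P a p ∧ MRel P b q ∧ m = p + q := by
  constructor
  · rintro ⟨S, hS, rfl⟩
    obtain ⟨T, U, hT, hU, rfl⟩ := Multiset.rel_add_left.1 hS
    exact ⟨_, _, ⟨T, hT, rfl⟩, ⟨U, hU, rfl⟩, Multiset.sum_add _ _⟩
  · rintro ⟨p, q, ⟨S, hS, rfl⟩, ⟨T, hT, rfl⟩, rfl⟩
    exact ⟨S + T, hS.add hT, Multiset.sum_add _ _⟩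

theorem singleton_left {i : ι} {m : M} : MRel P {i} m ↔ P i m := by
  simp [← Multiset.cons_zero, cons_left]

theorem map_left {Q : κ → M → Prop} {f : ι → κ} {a : Multiset ι} {m : M} :
    MRel Q (a.map f) m ↔ MRel (fun i => Q (f i)) a m := by
  simp only [MRel, Multiset.rel_map_left]

/-- Monotonicity, along an additive map. -/
theorem map {Q : ι → N → Prop} {a : Multiset ι} {m : M} (f : M →+ N) (h : MRel P a m)
    (hf : ∀ i ∈ a, ∀ p, P i p → Q i (f p)) : MRel Q a (f m) := by
  induction a using Multiset.induction generalizing m with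
  | empty => simp_all
  | cons i a ih =>
    obtain ⟨p, q, hp, hq, rfl⟩ := cons_left.1 h
    refine cons_left.2 ⟨f p, f q, hf i (Multiset.mem_cons_self i a) p hp, ih hq ?_, map_add f p q⟩
    exact fun j hj => hf j (Multiset.mem_cons_of_mem hj)

theorem mono {Q : ι → M → Prop} {a : Multiset ι} {m : M} (h : MRel P a m)
    (hf : ∀ i ∈ a, ∀ p, P i p → Q i p) : MRel Q a m :=
  h.map (AddMonoidHom.id M) hf

theorem eq_of_forall {a : Multiset ι} {m : M} {g : ι → M} (h : MRel P a m)
    (hg : ∀ i ∈ a, ∀ p, P i p → p = g i) : m = (a.map g).sum := by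
  induction a using Multiset.induction generalizing m with
  | empty => simp_all
  | cons i a ih =>
    obtain ⟨p, q, hp, hq, rfl⟩ := cons_left.1 h
    rw [Multiset.map_cons, Multiset.sum_cons, hg i (Multiset.mem_cons_self i a) p hp,
      ih hq fun j hj => hg j (Multiset.mem_cons_of_mem hj)]

theorem of_forall {a : Multiset ι} {g : ι → M} (hg : ∀ i ∈ a, P i (g i)) :
    MRel P a (a.map g).sum := by
  induction a using Multiset.induction with
  | empty => simp
  | cons i a ih =>
    refine cons_left.2 ⟨g i, _, hg i (Multiset.mem_cons_self i a),
      ih fun j hj => hg j (Multiset.mem_cons_of_mem hj), ?_⟩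
    rw [Multiset.map_cons, Multiset.sum_cons]

/-- The application rule indexes its premises by `Fin n`; this passes between such families and
multisets. -/
theorem ofFn_left {n : ℕ} {α : Fin n → ι} {m : M} :
    MRel P (Multiset.ofList (List.ofFn α)) m ↔ ∃ f : Fin n → M, (∀ i, P (α i) (f i)) ∧
      ∑ i, f i = m := by
  induction n generalizing m with
  | zero => simp [eq_comm]
  | succ n ih =>
    rw [List.ofFn_succ, ← Multiset.cons_coe, cons_left]
    constructor
    · rintro ⟨p, q, hp, hq, rfl⟩
      obtain ⟨f, hf, rfl⟩ := ih.1 hq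
      refine ⟨Fin.cons p f, fun i => ?_, by simp [Fin.sum_univ_succ]⟩
      cases i using Fin.cases with
      | zero => exact hp
      | succ i => exact hf i
    · rintro ⟨f, hf, rfl⟩
      exact ⟨f 0, _, hf 0, ih.2 ⟨fun i => f i.succ, fun i => hf i.succ, rfl⟩,
        Fin.sum_univ_succ f⟩

end MRel

/-! ### Contexts as multisets of declarations -/

section

variable {V : Type u} {A : Type v}

theorem Ty.arrow_inj {a b : Multiset (Ty A)} {α β : Ty A} (h : Ty.arrow a α = Ty.arrow b β) :
    a = b ∧ α = β := by
  simpa using congrArg (Ty.equivSum A) h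

/-- The declarations `x : α` of a context, as a multiset. -/
noncomputable def flat : Ctx V A →+ Multiset (V × Ty A) :=
  Finsupp.liftAddHom fun x => Multiset.mapAddMonoidHom (Prod.mk x)

theorem flat_single (x : V) (a : Multiset (Ty A)) :
    flat (Finsupp.single x a) = a.map (Prod.mk x) := by
  exact Finsupp.liftAddHom_apply_single _ x a

theorem mem_flat {Γ : Ctx V A} {p : V × Ty A} : p ∈ flat Γ ↔ p.2 ∈ Γ p.1 := by
  induction Γ using Finsupp.induction_linear with
  | zero => simp
  | add Γ Δ h₁ h₂ => simp [h₁, h₂]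
  | single x a =>
    classical
    obtain ⟨y, α⟩ := p
    by_cases h : x = y <;> simp [flat_single, h]

theorem ne_zero_of_mem_flat {Γ : Ctx V A} {p : V × Ty A} (h : p ∈ flat Γ) : Γ p.1 ≠ 0 := by
  intro h0
  simpa [h0] using mem_flat.1 h

/-! ### Typing with sizes -/

/-- `Typ t α (Γ, n)`: there is a derivation of `Γ ⊢ t : α` of size `n`. -/
def Typ : Term V → Ty A → Ctx V A × ℕ → Prop
  | .var x => fun α p => p = (Finsupp.single x {α}, 1)
  | .lam x t => fun α p => ∃ (Γ : Ctx V A) (a : Multiset (Ty A)) (β : Ty A) (n : ℕ),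
      Γ x = 0 ∧ Typ t β (Γ + Finsupp.single x a, n) ∧ α = Ty.arrow a β ∧ p = (Γ, n + 1)
  | .app t s => fun β p => ∃ (a : Multiset (Ty A)) (p₀ p₁ : Ctx V A × ℕ),
      Typ t (Ty.arrow a β) p₀ ∧ MRel (Typ s) a p₁ ∧ p = p₀ + p₁ + (0, 1)

/-- Together with its converse `Typ.exists_derivation`, this replaces derivations by a predicate
defined by recursion on the term, which is inverted by mere unfolding. -/
theorem Derivation.typ {Γ : Ctx V A} {t : Term V} {α : Ty A} (d : Derivation Γ t α) :
    Typ t α (Γ, d.size) := by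
  induction d with
  | var x α => rfl
  | lam hx d ih => exact ⟨_, _, _, _, hx, ih, rfl, rfl⟩
  | @app Γ₀ n Γ α β t s d ds ih ihs =>
    refine ⟨_, _, _, ih, MRel.ofFn_left.2 ⟨fun i => (Γ i, (ds i).size), ihs, rfl⟩, ?_⟩
    ext1 <;> simp [Derivation.size, Prod.fst_sum, Prod.snd_sum]

theorem Typ.exists_derivation {t : Term V} {α : Ty A} {Γ : Ctx V A} {n : ℕ}
    (h : Typ t α (Γ, n)) : ∃ d : Derivation Γ t α, d.size = n := by
  induction t generalizing α Γ n with
  | var x =>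
    cases h
    exact ⟨.var x α, rfl⟩
  | lam x t ih =>
    obtain ⟨Γ, a, β, n, hx, h, rfl, h'⟩ := h
    cases h'
    obtain ⟨d, rfl⟩ := ih h
    exact ⟨.lam hx d, rfl⟩
  | app t s iht ihs =>
    obtain ⟨a, ⟨Γ₀, n₀⟩, p₁, h₀, h₁, h⟩ := h
    obtain ⟨d, rfl⟩ := iht h₀
    -- The rule needs an enumeration of the multiset of argument types; any order will do.
    obtain ⟨l, rfl⟩ := Quot.exists_rep a
    obtain ⟨k, f, rfl⟩ : ∃ (k : ℕ) (f : Fin k → Ty A), l = List.ofFn f :=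
      ⟨_, l.get, (List.ofFn_get l).symm⟩
    obtain ⟨g, hg, rfl⟩ := MRel.ofFn_left.1 h₁
    choose ds hds using fun i => ihs (hg i)
    have hΓ : Γ = Γ₀ + ∑ i, (g i).1 := by simpa [Prod.fst_sum] using congrArg Prod.fst h
    have hn : n = d.size + ∑ i, (g i).2 + 1 := by
      simpa [Prod.snd_sum] using congrArg Prod.snd h
    subst hΓ hn
    exact ⟨.app d ds, by simp [Derivation.size, hds]⟩

end

/-! ### Typed closures and states, and their sizes along machine steps -/

section Machine

variable {V : Type u} {A : Type v}

/-- Puts any context into the form required by the abstraction rule, with `Γ x` as the multiset to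
be discharged. -/
theorem exists_add_single (Γ : Ctx V A) (x : V) :
    ∃ Δ : Ctx V A, Δ x = 0 ∧ Γ = Δ + Finsupp.single x (Γ x) :=
  ⟨Γ.erase x, Finsupp.erase_same, (Finsupp.erase_add_single x Γ).symm⟩

variable [DecidableEq V]

/-- A declaration `x : α`, for an environment with domain `dom` whose value at `x ∈ dom` has the
type `α` with size `n` if `P x α n`. Other variables are free, and cost nothing. -/
def EnvTyp (dom : Finset V) (P : {x : V // x ∈ dom} → Ty A → ℕ → Prop) (q : V × Ty A) (n : ℕ) :
    Prop :=
  if h : q.1 ∈ dom then P ⟨q.1, h⟩ q.2 n else n = 0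

/-- `c.Typ α n`: the closure `c` has type `α`, with derivations of total size `n` for its term and
for the closures of its environment. -/
def Clos.Typ : Clos V → Ty A → ℕ → Prop
  | .mk t dom val => fun α n => ∃ (Γ : Ctx V A) (m k : ℕ), HeadKrivine.Typ t α (Γ, m) ∧
      MRel (EnvTyp dom fun x => Clos.Typ (val x)) (flat Γ) k ∧ n = m + k

/-- `stackTyp π α n`: the stack `π` can be the arguments of a function of type `α`. -/
def stackTyp : List (Clos V) → Ty A → ℕ → Prop
  | [] => fun _ n => n = 0
  | c :: π => fun α n => ∃ (a : Multiset (Ty A)) (β : Ty A) (k m : ℕ), α = Ty.arrow a β ∧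
      MRel c.Typ a k ∧ stackTyp π β m ∧ n = k + m

variable (A) in
/-- `s.Typ n`: the state `s` can be typed with total size `n`. -/
def State.Typ (s : State V) (n : ℕ) : Prop :=
  ∃ (α : Ty A) (k m : ℕ), s.clos.Typ α k ∧ stackTyp s.stack α m ∧ n = k + m

theorem Clos.typ_ofTerm {t : Term V} {α : Ty A} {n : ℕ} :
    (Clos.ofTerm t).Typ α n ↔ ∃ Γ, HeadKrivine.Typ t α (Γ, n) := by
  constructor
  · rintro ⟨Γ, m, k, ht, hk, rfl⟩
    have : k = 0 := by
      rw [hk.eq_of_forall (g := fun _ => 0) fun i _ p hp => by simpa [EnvTyp] using hp]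
      simp
    exact ⟨Γ, by simpa [this] using ht⟩
  · rintro ⟨Γ, ht⟩
    refine ⟨Γ, n, _, ht, MRel.of_forall (g := fun _ => 0) fun i _ => by simp [EnvTyp], by simp⟩

theorem State.typ_init {t : Term V} {n : ℕ} :
    (State.init t).Typ A n ↔ ∃ Γ α, HeadKrivine.Typ (A := A) t α (Γ, n) := by
  constructor
  · rintro ⟨α, k, m, hk, rfl, rfl⟩
    obtain ⟨Γ, h⟩ := Clos.typ_ofTerm.1 hk
    exact ⟨Γ, α, h⟩
  · rintro ⟨Γ, α, h⟩
    exact ⟨α, n, 0, Clos.typ_ofTerm.2 ⟨Γ, h⟩, rfl, rfl⟩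

/-- The closures in the environment are typed once per declaration, so typings of one closure by
several types merge into a joint typing of its term and one of the environment against the summed
context, and split again. This is what lets an application share its environment between function
and argument. -/
theorem mrel_clos_mk {s : Term V} {dom : Finset V} {val : {x : V // x ∈ dom} → Clos V}
    {a : Multiset (Ty A)} {n : ℕ} :
    MRel (Clos.mk s dom val).Typ a n ↔ ∃ (Γ : Ctx V A) (m k : ℕ), MRel (Typ s) a (Γ, m) ∧
      MRel (EnvTyp dom fun x => (val x).Typ) (flat Γ) k ∧ n = m + k := by
  induction a using Multiset.induction generalizing n with
  | empty =>
    simp only [MRel.zero_left, Prod.mk_eq_zero]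
    constructor
    · rintro rfl
      exact ⟨0, 0, 0, ⟨rfl, rfl⟩, by simp, rfl⟩
    · rintro ⟨_, _, k, ⟨rfl, rfl⟩, hk, rfl⟩
      simpa using hk
  | cons α a ih =>
    simp only [MRel.cons_left]
    constructor
    · rintro ⟨p, q, ⟨Γ, m, k, h, hk, rfl⟩, hq, rfl⟩
      obtain ⟨Γ', m', k', h', hk', rfl⟩ := ih.1 hq
      refine ⟨Γ + Γ', m + m', k + k', ⟨_, _, h, h', rfl⟩, ?_, by omega⟩
      rw [map_add]
      exact MRel.add_left.2 ⟨k, k', hk, hk', rfl⟩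
    · rintro ⟨_, _, _, ⟨⟨Γ, m⟩, ⟨Γ', m'⟩, h, h', hp⟩, h₀, rfl⟩
      cases hp
      rw [map_add] at h₀
      obtain ⟨k, k', hk, hk', rfl⟩ := MRel.add_left.1 h₀
      exact ⟨_, _, ⟨Γ, m, k, h, hk, rfl⟩, ih.2 ⟨Γ', m', k', h', hk', rfl⟩, by omega⟩

/-- As `Γ` does not declare `x`, its declarations are looked up in the old environment, and those of
`a` all in the new closure `c`. -/
theorem mrel_envTyp_extend {dom : Finset V} {val : {x : V // x ∈ dom} → Clos V} {x : V}
    {c : Clos V} {Γ : Ctx V A} {a : Multiset (Ty A)} {n : ℕ} (hx : Γ x = 0) :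
    MRel (EnvTyp (insert x dom) fun y => (Clos.extend dom val x c y).Typ)
      (flat (Γ + Finsupp.single x a)) n ↔
    ∃ k l, MRel (EnvTyp dom fun y => (val y).Typ) (flat Γ) k ∧ MRel c.Typ a l ∧ n = k + l := by
  have h₁ : ∀ q ∈ flat Γ, ∀ m, EnvTyp (insert x dom) (fun y => (Clos.extend dom val x c y).Typ)
      q m ↔ EnvTyp dom (fun y => (val y).Typ) q m := by
    intro q hq m
    have hne : q.1 ≠ x := fun h => ne_zero_of_mem_flat hq (h ▸ hx)
    by_cases h : q.1 ∈ dom <;> simp [EnvTyp, Clos.extend, hne, h]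
  have h₂ : ∀ α m, EnvTyp (insert x dom) (fun y => (Clos.extend dom val x c y).Typ) (x, α) m ↔
      c.Typ (A := A) α m := by
    intro α m
    simp [EnvTyp, Clos.extend]
  rw [map_add, MRel.add_left, flat_single]
  simp only [MRel.map_left]
  constructor
  · rintro ⟨k, l, hk, hl, rfl⟩
    exact ⟨k, l, hk.mono fun q hq m => (h₁ q hq m).1,
      hl.mono fun α _ m => (h₂ α m).1, rfl⟩
  · rintro ⟨k, l, hk, hl, rfl⟩
    exact ⟨k, l, hk.mono fun q hq m => (h₁ q hq m).2,
      hl.mono fun α _ m => (h₂ α m).2, rfl⟩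

/-- Declarations of variables outside the domain have cost 0. -/
theorem mrel_envTyp_single {dom : Finset V} {P : {x : V // x ∈ dom} → Ty A → ℕ → Prop} {x : V}
    {Γ : Ctx V A} {a : Multiset (Ty A)} {n : ℕ} (hx : x ∉ dom) :
    MRel (EnvTyp dom P) (flat (Γ + Finsupp.single x a)) n ↔ MRel (EnvTyp dom P) (flat Γ) n := by
  have h : ∀ m, MRel (EnvTyp dom P) (a.map (Prod.mk x)) m ↔ m = 0 := by
    intro m
    rw [MRel.map_left]
    constructor
    · intro h
      rw [h.eq_of_forall (g := fun _ => 0) fun i _ p hp => by simpa [EnvTyp, hx] using hp]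
      simp
    · rintro rfl
      have := MRel.of_forall (P := fun α => EnvTyp dom P (x, α)) (a := a) (g := fun _ => 0)
        fun i _ => by simp [EnvTyp, hx]
      simpa using this
  simp [map_add, MRel.add_left, flat_single, h]

/-- Each execution step decreases the size by one. -/
theorem State.typ_iff_of_step {s s' : State V} (h : s.step = some s') {n : ℕ} :
    s.Typ A n ↔ ∃ m, s'.Typ A m ∧ n = m + 1 := by
  obtain ⟨⟨t, dom, val⟩, π⟩ := s
  cases t with
  | var x =>
    simp only [State.step] at h
    split at h
    case isFalse => cases h
    case isTrue hx =>
    cases h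
    constructor
    · rintro ⟨α, _, m, ⟨Γ, _, k, h, hk, rfl⟩, hm, rfl⟩
      cases h
      rw [flat_single, Multiset.map_singleton, MRel.singleton_left, EnvTyp, dif_pos hx] at hk
      -- The size lost is that of the axiom, 1.
      exact ⟨k + m, ⟨α, k, m, hk, hm, rfl⟩, by omega⟩
    · rintro ⟨_, ⟨α, k, m, hk, hm, rfl⟩, rfl⟩
      refine ⟨α, 1 + k, m, ⟨_, 1, k, rfl, ?_, rfl⟩, hm, by omega⟩
      rw [flat_single, Multiset.map_singleton, MRel.singleton_left, EnvTyp, dif_pos hx]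
      exact hk
  | app t s =>
    cases h
    constructor
    · rintro ⟨α, _, m, ⟨_, _, _, ⟨a, ⟨Γ, n⟩, ⟨Γ', n'⟩, h, h', hp⟩, h₀, rfl⟩, hm, rfl⟩
      cases hp
      simp only [add_zero, Prod.mk_add_mk] at h₀
      rw [map_add] at h₀
      obtain ⟨k, k', hk, hk', rfl⟩ := MRel.add_left.1 h₀
      exact ⟨_, ⟨_, _, _, ⟨Γ, n, k, h, hk, rfl⟩,
        ⟨a, α, _, m, rfl, mrel_clos_mk.2 ⟨Γ', n', k', h', hk', rfl⟩, hm, rfl⟩, rfl⟩,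
        by change n + n' + 1 + (k + k') + m = _; omega⟩
    · rintro ⟨_, ⟨_, _, _, ⟨Γ, n, k, h, hk, rfl⟩, ⟨a, α, _, m, rfl, hs, hm, rfl⟩, rfl⟩, rfl⟩
      obtain ⟨Γ', n', k', h', hk', rfl⟩ := mrel_clos_mk.1 hs
      refine ⟨α, _, m, ⟨Γ + Γ', n + n' + 1, k + k', ⟨a, _, _, h, h', ?_⟩, ?_, rfl⟩, hm, ?_⟩
      · simp
      · rw [map_add]
        exact MRel.add_left.2 ⟨k, k', hk, hk', rfl⟩
      · omega
  | lam x t =>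
    cases π with
    | nil => cases h
    | cons c π =>
      cases h
      constructor
      · rintro ⟨_, _, _, ⟨_, _, k, ⟨Γ, a, β, n, hx, h, hτ, hp⟩, hk, rfl⟩,
          ⟨b, α, l, m, rfl, hc, hm, rfl⟩, rfl⟩
        cases hp
        obtain ⟨rfl, rfl⟩ := Ty.arrow_inj hτ
        exact ⟨_, ⟨α, _, m, ⟨_, n, k + l, h, (mrel_envTyp_extend hx).2 ⟨k, l, hk, hc, rfl⟩, rfl⟩,
          hm, rfl⟩, by omega⟩
      · rintro ⟨_, ⟨α, _, m, ⟨Γ, n, _, h, h₀, rfl⟩, hm, rfl⟩, rfl⟩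
        -- The types at which the body uses `x` form the multiset by which the popped closure must
        -- be typed.
        obtain ⟨Δ, hx, hΓ⟩ := exists_add_single Γ x
        rw [hΓ] at h h₀
        obtain ⟨k, l, hk, hc, rfl⟩ := (mrel_envTyp_extend hx).1 h₀
        exact ⟨_, _, _, ⟨Δ, n + 1, k, ⟨Δ, _, α, n, hx, h, rfl, rfl⟩, hk, rfl⟩,
          ⟨_, α, l, m, rfl, hc, hm, rfl⟩, by omega⟩

/-- Under the binder `x` becomes a free variable, whose declarations cost nothing because `x` is not
in the domain; only the abstraction node is lost. -/
theorem State.typ_lam_nil {x : V} {t : Term V} {dom : Finset V}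
    {val : {x : V // x ∈ dom} → Clos V} {n : ℕ} (hx : x ∉ dom) :
    State.Typ A ⟨.mk (.lam x t) dom val, []⟩ n ↔
      ∃ m, State.Typ A ⟨.mk t dom val, []⟩ m ∧ n = m + 1 := by
  constructor
  · rintro ⟨_, _, _, ⟨_, _, k, ⟨Γ, a, β, n, -, h, rfl, hp⟩, hk, rfl⟩, rfl, rfl⟩
    cases hp
    exact ⟨_, ⟨β, _, 0, ⟨_, n, k, h, (mrel_envTyp_single hx).2 hk, rfl⟩, rfl, rfl⟩, by omega⟩
  · rintro ⟨_, ⟨β, _, _, ⟨Γ, n, k, h, hk, rfl⟩, rfl, rfl⟩, rfl⟩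
    obtain ⟨Δ, hx', hΓ⟩ := exists_add_single Γ x
    rw [hΓ] at h hk
    exact ⟨_, _, 0, ⟨Δ, n + 1, k, ⟨Δ, _, β, n, hx', h, rfl, rfl⟩, (mrel_envTyp_single hx).1 hk,
      rfl⟩, rfl, by omega⟩

/-- Give every argument the empty multiset, so that none needs to be typed. The final result type
can be any type; an atom provides one. -/
theorem exists_stackTyp_zero [Nonempty A] (π : List (Clos V)) : ∃ α : Ty A, stackTyp π α 0 := by
  induction π with
  | nil => exact ⟨Ty.atom (Classical.arbitrary A), rfl⟩
  | cons c π ih =>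
    obtain ⟨α, h⟩ := ih
    exact ⟨Ty.arrow 0 α, 0, α, 0, 0, rfl, by simp, h, rfl⟩

theorem State.typ_var_one [Nonempty A] {x : V} {dom : Finset V}
    {val : {x : V // x ∈ dom} → Clos V} {π : List (Clos V)} (hx : x ∉ dom) :
    State.Typ A ⟨.mk (.var x) dom val, π⟩ 1 := by
  obtain ⟨α, h⟩ := exists_stackTyp_zero (A := A) π
  refine ⟨α, 1, 0, ⟨_, 1, 0, rfl, ?_, rfl⟩, h, rfl⟩
  rw [flat_single, Multiset.map_singleton, MRel.singleton_left, EnvTyp, dif_neg hx]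

omit [DecidableEq V] in
theorem Typ.pos {t : Term V} {α : Ty A} {p : Ctx V A × ℕ} (h : Typ t α p) : 0 < p.2 := by
  cases t with
  | var x => cases h; exact Nat.one_pos
  | lam x t =>
    obtain ⟨Γ, a, β, n, -, -, -, rfl⟩ := h
    exact n.succ_pos
  | app t s =>
    obtain ⟨a, p, q, -, -, rfl⟩ := h
    exact Nat.succ_pos _

theorem State.Typ.pos {s : State V} {n : ℕ} (h : s.Typ A n) : 0 < n := by
  obtain ⟨⟨t, dom, val⟩, π⟩ := s
  obtain ⟨α, _, m, ⟨Γ, l, k, h, -, rfl⟩, -, rfl⟩ := h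
  have := h.pos
  dsimp only at this
  omega

omit [DecidableEq V] in
theorem State.RespectsConvention.notMem_of_lam {x : V} {t : Term V} {dom : Finset V}
    {val : {x : V // x ∈ dom} → Clos V} {π : List (Clos V)}
    (h : State.RespectsConvention ⟨.mk (.lam x t) dom val, π⟩) : x ∉ dom :=
  fun hx => h.1.2.1 x hx (Multiset.mem_cons_self x _)

omit [DecidableEq V] in
theorem State.RespectsConvention.of_lam {x : V} {t : Term V} {dom : Finset V}
    {val : {x : V // x ∈ dom} → Clos V} {π : List (Clos V)}
    (h : State.RespectsConvention ⟨.mk (.lam x t) dom val, π⟩) :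
    State.RespectsConvention ⟨.mk t dom val, π⟩ :=
  ⟨⟨(Multiset.nodup_cons.1 h.1.1).2, fun y hy hy' => h.1.2.1 y hy (Multiset.mem_cons_of_mem hy'),
    h.1.2.2⟩, h.2⟩

/-! ### Halting of the machine and typability -/

variable [Infinite V]

theorem Conf.haltsIn_lam {y : V} {k : Conf V} {n : ℕ} :
    (Conf.lam y k).HaltsIn n ↔ k.HaltsIn n := by
  induction n generalizing k with
  | zero => simp [Conf.HaltsIn, Conf.step]
  | succ n ih =>
    simp only [Conf.HaltsIn, Conf.step, Option.map_eq_some_iff]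
    constructor
    · rintro ⟨_, ⟨k', h, rfl⟩, hn⟩
      exact ⟨k', h, ih.1 hn⟩
    · rintro ⟨k', h, hn⟩
      exact ⟨_, ⟨k', h, rfl⟩, ih.2 hn⟩

/-- Hence no state halts in 0 steps, which matches the positivity of sizes. -/
theorem Conf.step_ne_none (s : State V) : (Conf.state s).step ≠ none := by
  obtain ⟨⟨t, dom, val⟩, π⟩ := s
  cases t with
  | var x => by_cases h : x ∈ dom <;> simp [Conf.step, State.step, h]
  | lam x t => cases π <;> simp [Conf.step, State.step]
  | app t s => simp [Conf.step, State.step]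

theorem Conf.haltsIn_of_step {s s' : State V} (h : s.step = some s') {n : ℕ} :
    (Conf.state s).HaltsIn (n + 1) ↔ (Conf.state s').HaltsIn n := by
  simp [Conf.HaltsIn, Conf.step, h]

theorem Conf.haltsIn_lam_nil {x : V} {t : Term V} {dom : Finset V}
    {val : {x : V // x ∈ dom} → Clos V} {n : ℕ} :
    (Conf.state ⟨.mk (.lam x t) dom val, []⟩).HaltsIn (n + 1) ↔
      (Conf.state ⟨.mk t dom val, []⟩).HaltsIn n := by
  rw [← Conf.haltsIn_lam (y := x) (k := .state ⟨.mk t dom val, []⟩), Conf.HaltsIn]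
  simp [Conf.step, State.step]

theorem Conf.haltsIn_var {x : V} {dom : Finset V} {val : {x : V // x ∈ dom} → Clos V}
    {π : List (Clos V)} (hx : x ∉ dom) {n : ℕ} :
    (Conf.state ⟨.mk (.var x) dom val, π⟩).HaltsIn n ↔ n = 1 := by
  rcases n with _ | _ | n <;> simp [Conf.HaltsIn, Conf.step, State.step, hx]

omit [Infinite V] in
/-- A state on which no execution is possible has a variable or an abstraction as its head. -/
theorem State.step_eq_none {s : State V} (h : s.step = none) :
    (∃ x dom val π, x ∉ dom ∧ s = ⟨.mk (.var x) dom val, π⟩) ∨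
      ∃ x t dom val, s = ⟨.mk (.lam x t) dom val, []⟩ := by
  obtain ⟨⟨t, dom, val⟩, π⟩ := s
  cases t with
  | var x =>
    by_cases hx : x ∈ dom
    · simp [State.step, hx] at h
    · exact .inl ⟨x, dom, val, π, hx, rfl⟩
  | lam x t =>
    cases π with
    | nil => exact .inr ⟨x, t, dom, val, rfl⟩
    | cons c π => simp [State.step] at h
  | app t s => simp [State.step] at h

/-- A state from which the machine halts has a typing whose size is the number of steps. -/
theorem State.typ_of_haltsIn [Nonempty A] {s : State V} (hs : s.RespectsConvention) {n : ℕ}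
    (h : (Conf.state s).HaltsIn n) : s.Typ A n := by
  induction n generalizing s with
  | zero => exact absurd h (Conf.step_ne_none s)
  | succ n ih =>
    cases hstep : s.step with
    | some s' =>
      exact (State.typ_iff_of_step hstep).2
        ⟨n, ih (hs.step hstep) ((Conf.haltsIn_of_step hstep).1 h), rfl⟩
    | none =>
      rcases State.step_eq_none hstep with ⟨x, dom, val, π, hx, rfl⟩ | ⟨x, t, dom, val, rfl⟩
      · rw [Conf.haltsIn_var hx] at h
        rw [h]
        exact State.typ_var_one hx
      · exact (State.typ_lam_nil hs.notMem_of_lam).2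
          ⟨n, ih hs.of_lam (Conf.haltsIn_lam_nil.1 h), rfl⟩

/-- From a typed state the machine halts, in at most as many steps as the size of the typing. -/
theorem State.Typ.exists_haltsIn {s : State V} (hs : s.RespectsConvention) {n : ℕ}
    (h : s.Typ A n) : ∃ m ≤ n, (Conf.state s).HaltsIn m := by
  induction n generalizing s with
  | zero => exact absurd h.pos (lt_irrefl 0)
  | succ n ih =>
    cases hstep : s.step with
    | some s' =>
      obtain ⟨n', h', hn⟩ := (State.typ_iff_of_step hstep).1 h
      obtain rfl : n = n' := by omega
      obtain ⟨m, hm, hm'⟩ := ih (hs.step hstep) h'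
      exact ⟨m + 1, by omega, (Conf.haltsIn_of_step hstep).2 hm'⟩
    | none =>
      rcases State.step_eq_none hstep with ⟨x, dom, val, π, hx, rfl⟩ | ⟨x, t, dom, val, rfl⟩
      · exact ⟨1, by omega, (Conf.haltsIn_var hx).2 rfl⟩
      · obtain ⟨n', h', hn⟩ := (State.typ_lam_nil hs.notMem_of_lam).1 h
        obtain rfl : n = n' := by omega
        obtain ⟨m, hm, hm'⟩ := ih hs.of_lam h'
        exact ⟨m + 1, by omega, Conf.haltsIn_lam_nil.2 hm'⟩

end Machine

/-! ### Renaming, α-equivalence and the variable convention -/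

namespace Term

variable {V : Type u}

theorem rename_rename (π ρ : V → V) (t : Term V) : (t.rename π).rename ρ = t.rename (ρ ∘ π) := by
  induction t <;> simp_all [rename]

theorem rename_id (t : Term V) : t.rename id = t := by
  induction t <;> simp_all [rename]

theorem bound_rename (π : V → V) (t : Term V) : (t.rename π).bound = t.bound.map π := by
  induction t <;> simp_all [rename, bound]

variable [DecidableEq V]

theorem rename_congr {π ρ : V → V} {t : Term V} (h : ∀ x ∈ t.vars, π x = ρ x) :
    t.rename π = t.rename ρ := by
  induction t with
  | var x => simp_all [rename, vars]
  | app t s iht ihs =>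
    simp only [vars, Finset.mem_union] at h
    simp only [rename, iht fun x hx => h x (.inl hx), ihs fun x hx => h x (.inr hx)]
  | lam x t ih =>
    simp only [vars, Finset.mem_insert] at h
    simp only [rename, h x (.inl rfl), ih fun y hy => h y (.inr hy)]

theorem vars_rename (π : V → V) (t : Term V) : (t.rename π).vars = t.vars.image π := by
  induction t <;> simp_all [rename, vars, Finset.image_union, Finset.image_insert]

theorem fv_rename (π : Equiv.Perm V) (t : Term V) : (t.rename π).fv = t.fv.image π := by
  induction t with
  | var x => simp [rename, fv]
  | app t s iht ihs => simp [rename, fv, iht, ihs, Finset.image_union]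
  | lam x t ih => simp [rename, fv, ih, Finset.image_erase π.injective]

theorem fv_subset_vars (t : Term V) : t.fv ⊆ t.vars := by
  induction t with
  | var x => exact subset_rfl
  | app t s iht ihs => exact Finset.union_subset_union iht ihs
  | lam x t ih =>
    exact (Finset.erase_subset x _).trans (ih.trans (Finset.subset_insert x _))

theorem mem_vars_of_mem_bound {x : V} {t : Term V} (h : x ∈ t.bound) : x ∈ t.vars := by
  induction t <;> simp_all [bound, vars]
  all_goals grind

theorem AlphaEq.symm {t s : Term V} (h : AlphaEq t s) : AlphaEq s t := by
  induction h with
  | var x => exact .var x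
  | app _ _ iht ihs => exact .app iht ihs
  | lam hx hy ht hs _ ih => exact .lam hy hx hs ht ih

theorem AlphaEq.rename {t s : Term V} (h : AlphaEq t s) (π : Equiv.Perm V) :
    AlphaEq (t.rename π) (s.rename π) := by
  induction h with
  | var x => exact .var _
  | app _ _ iht ihs => exact .app iht ihs
  | @lam x y z t s hx hy ht hs _ ih =>
    -- Conjugating the transposition of `w` and `z` by `π` gives that of `π w` and `π z`.
    have key : ∀ (w : V) (r : Term V), (r.rename (Equiv.swap w z)).rename π =
        (r.rename π).rename (Equiv.swap (π w) (π z)) := by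
      intro w r
      rw [rename_rename, rename_rename]
      congr 1
      ext v
      simp [Equiv.swap_apply_def, π.injective.eq_iff]
      split_ifs <;> rfl
    refine .lam (z := π z) (π.injective.ne hx) (π.injective.ne hy) ?_ ?_ ?_
    · simpa [vars_rename] using ht
    · simpa [vars_rename] using hs
    · rwa [← key, ← key]

/-- Every term is α-equivalent to one that respects the variable convention and whose bound
variables avoid a given finite set. -/
theorem exists_alphaEq_respectsConvention [Infinite V] (t : Term V) (S : Finset V) :
    ∃ u, AlphaEq t u ∧ u.RespectsConvention ∧ ∀ x ∈ u.bound, x ∉ S := by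
  induction t generalizing S with
  | var x => exact ⟨.var x, .var x, Multiset.nodup_zero, by simp [bound]⟩
  | app t s iht ihs =>
    obtain ⟨t', ht, htn, htS⟩ := iht S
    -- Avoiding all variables of `t'` keeps the two families of bound variables disjoint.
    obtain ⟨s', hs, hsn, hsS⟩ := ihs (S ∪ t'.vars)
    refine ⟨.app t' s', .app ht hs, Multiset.nodup_add.2 ⟨htn, hsn, ?_⟩, ?_⟩
    · refine Multiset.disjoint_left.2 fun {x} hx hx' => hsS x hx' ?_
      exact Finset.mem_union_right _ (mem_vars_of_mem_bound hx)
    · intro x hx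
      rcases Multiset.mem_add.1 hx with hx | hx
      · exact htS x hx
      · exact fun h => hsS x hx (Finset.mem_union_left _ h)
  | lam x t ih =>
    -- The bound variables of `u` avoid `x`, so that replacing `x` by a fresh binder `y` leaves them
    -- unchanged; `z` below is the witness for the α-rule.
    obtain ⟨u, hu, hun, huS⟩ := ih (insert x S)
    obtain ⟨y, hy⟩ := Infinite.exists_notMem_finset (insert x (S ∪ u.vars))
    simp only [Finset.mem_insert, Finset.mem_union, not_or] at hy
    obtain ⟨z, hz⟩ := Infinite.exists_notMem_finset (insert x (insert y (t.vars ∪ u.vars)))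
    simp only [Finset.mem_insert, Finset.mem_union, not_or] at hz
    have hb : (u.rename (Equiv.swap x y)).bound = u.bound := by
      rw [bound_rename]
      conv_rhs => rw [← Multiset.map_id u.bound]
      refine Multiset.map_congr rfl fun v hv => Equiv.swap_apply_of_ne_of_ne ?_ ?_
      · rintro rfl
        exact huS v hv (Finset.mem_insert_self v S)
      · rintro rfl
        exact hy.2.2 (mem_vars_of_mem_bound hv)
    refine ⟨.lam y (u.rename (Equiv.swap x y)), .lam (z := z) hz.1 hz.2.1 hz.2.2.1 ?_ ?_, ?_, ?_⟩
    · rw [vars_rename, Finset.mem_image]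
      rintro ⟨v, hv, h⟩
      have : v = z := by
        rw [Equiv.swap_apply_eq_iff, Equiv.swap_apply_of_ne_of_ne hz.1 hz.2.1] at h
        exact h
      exact hz.2.2.2 (this ▸ hv)
    · have : (u.rename (Equiv.swap x y)).rename (Equiv.swap y z) = u.rename (Equiv.swap x z) := by
        rw [rename_rename]
        refine rename_congr fun v hv => ?_
        have hvy : v ≠ y := fun h => hy.2.2 (h ▸ hv)
        have hvz : v ≠ z := fun h => hz.2.2.2 (h ▸ hv)
        by_cases hvx : v = x
        · simp [hvx]
        · simp [Equiv.swap_apply_of_ne_of_ne, hvx, hvy, hvz]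
      rw [this]
      exact hu.rename _
    · rw [RespectsConvention, bound, hb, Multiset.nodup_cons]
      exact ⟨fun h => hy.2.2 (mem_vars_of_mem_bound h), hun⟩
    · intro v hv
      rw [bound, hb, Multiset.mem_cons] at hv
      rcases hv with rfl | hv
      · exact hy.2.1
      · exact fun h => huS v hv (Finset.mem_insert_of_mem h)

end Term

/-! ### Invariance of typings under α-equivalence -/

section Typing

variable {V : Type u} {A : Type v}

/-- Typing is equivariant. -/
theorem Typ.rename (π : Equiv.Perm V) {t : Term V} {α : Ty A} {Γ : Ctx V A} {n : ℕ}
    (h : Typ t α (Γ, n)) : Typ (t.rename π) α (Γ.mapDomain π, n) := by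
  induction t generalizing α Γ n with
  | var x =>
    cases h
    simp [Term.rename, Typ, Finsupp.mapDomain_single]
  | lam x t ih =>
    obtain ⟨Γ, a, β, n, hx, h, rfl, h'⟩ := h
    cases h'
    refine ⟨_, a, β, n, ?_, ?_, rfl, rfl⟩
    · rwa [Finsupp.mapDomain_apply π.injective]
    · simpa [Finsupp.mapDomain_add, Finsupp.mapDomain_single] using ih h
  | app t s iht ihs =>
    obtain ⟨a, ⟨Γ₀, n₀⟩, ⟨Γ₁, n₁⟩, h₀, h₁, hp⟩ := h
    cases hp
    refine ⟨a, _, (Γ₁.mapDomain π, n₁), iht h₀, ?_, ?_⟩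
    · exact h₁.map ((Finsupp.mapDomain.addMonoidHom π).prodMap (AddMonoidHom.id ℕ))
        fun α _ p hp => ihs hp
    · simp [Finsupp.mapDomain_add]

variable [DecidableEq V]

omit [DecidableEq V] in
theorem MRel.apply_fst_eq_zero {ι : Type*} {P : ι → Ctx V A × ℕ → Prop} {a : Multiset ι}
    {p : Ctx V A × ℕ} (h : MRel P a p) {y : V} (hy : ∀ i ∈ a, ∀ p, P i p → p.1 y = 0) :
    p.1 y = 0 := by
  have h' : MRel (fun _ b => b = 0) a (p.1 y) :=
    h.map ((Finsupp.applyAddHom y).comp (AddMonoidHom.fst _ _)) hy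
  simpa using h'.eq_of_forall (g := fun _ => 0) fun _ _ _ h => h

/-- System R has no weakening: declarations come only from axioms. -/
theorem Typ.eq_zero_of_notMem_fv {t : Term V} {α : Ty A} {p : Ctx V A × ℕ} (h : Typ t α p) {y : V}
    (hy : y ∉ t.fv) : p.1 y = 0 := by
  induction t generalizing α p with
  | var x =>
    cases h
    have : y ≠ x := by simpa [Term.fv] using hy
    simp [this.symm]
  | lam x t ih =>
    obtain ⟨Γ, a, β, n, hx, h, rfl, rfl⟩ := h
    by_cases hyx : y = x
    · rwa [hyx]
    · have := ih h fun hy' => hy (Finset.mem_erase.2 ⟨hyx, hy'⟩)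
      rw [Finsupp.add_apply, add_eq_zero] at this
      exact this.1
  | app t s iht ihs =>
    obtain ⟨a, p₀, p₁, h₀, h₁, rfl⟩ := h
    rw [Term.fv, Finset.mem_union, not_or] at hy
    have e : p₁.1 y = 0 :=
      h₁.apply_fst_eq_zero fun α _ p hp => ihs hp hy.2
    simp [iht h₀ hy.1, e]

theorem mapDomain_swap {x z : V} {Γ : Ctx V A} (hx : Γ x = 0) (hz : Γ z = 0) :
    Γ.mapDomain (Equiv.swap x z) = Γ := by
  ext1 y
  rw [← Finsupp.equivMapDomain_eq_mapDomain, Finsupp.equivMapDomain_apply, Equiv.symm_swap,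
    Equiv.swap_apply_def]
  split_ifs with h₁ h₂
  · rw [h₁, hx, hz]
  · rw [h₂, hx, hz]
  · rfl

/-- α-equivalent terms have the same typings, with the same sizes. -/
theorem Typ.alphaEq {t u : Term V} (h : Term.AlphaEq t u) {α : Ty A} {Γ : Ctx V A} {n : ℕ}
    (ht : Typ t α (Γ, n)) : Typ u α (Γ, n) := by
  induction h generalizing α Γ n with
  | var x => exact ht
  | app _ _ iht ihs =>
    obtain ⟨a, p₀, p₁, h₀, h₁, hp⟩ := ht
    exact ⟨a, p₀, p₁, iht h₀, h₁.mono fun α _ p hp => ihs hp, hp⟩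
  | @lam x y z t s hx hy hzt hzs _ ih =>
    obtain ⟨Γ, a, β, n, hΓx, ht, rfl, hp⟩ := ht
    cases hp
    have hΓz : Γ z = 0 := by
      have := ht.eq_zero_of_notMem_fv fun h => hzt (t.fv_subset_vars h)
      rw [Finsupp.add_apply, add_eq_zero] at this
      exact this.1
    -- Rename `x` to `z`, use the induction hypothesis, then rename `z` to `y`; `Γ` is fixed by both
    -- swaps, since it declares none of `x`, `y`, `z`.
    have hs := ht.rename (Equiv.swap x z)
    rw [Finsupp.mapDomain_add, Finsupp.mapDomain_single, Equiv.swap_apply_left,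
      mapDomain_swap hΓx hΓz] at hs
    have hs' := (ih hs).rename (Equiv.swap y z)
    have hΓy : Γ y = 0 := by
      have := (ih hs).eq_zero_of_notMem_fv (y := y) ?_
      · rw [Finsupp.add_apply, add_eq_zero] at this
        exact this.1
      -- If `y` were free after the swap, `z` would be free in `s`.
      · rw [Term.fv_rename, Finset.mem_image]
        rintro ⟨v, hv, h⟩
        rw [Equiv.swap_apply_eq_iff, Equiv.swap_apply_left] at h
        exact hzs (s.fv_subset_vars (h ▸ hv))
    rw [Finsupp.mapDomain_add, Finsupp.mapDomain_single, Equiv.swap_apply_right,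
      mapDomain_swap hΓy hΓz, Term.rename_rename] at hs'
    refine ⟨Γ, a, β, n, hΓy, ?_, rfl, rfl⟩
    have e : s.rename (Equiv.swap y z ∘ Equiv.swap y z) = s.rename id :=
      Term.rename_congr fun v _ => by simp
    rwa [e, Term.rename_id] at hs'

end Typing

/-! ### Substitution, head reduction and head normalization -/

section SubjectReduction

variable {V : Type u} {A : Type v}

theorem mrel_typ_var (z : V) (a : Multiset (Ty A)) :
    MRel (Typ (.var z)) a (Finsupp.single z a, a.card) := by
  induction a using Multiset.induction with
  | empty => simp
  | cons α a ih =>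
    refine MRel.cons_left.2 ⟨_, _, rfl, ih, ?_⟩
    rw [Prod.mk_add_mk, ← Finsupp.single_add, Multiset.singleton_add, Multiset.card_cons, add_comm]

/-- The identity substitution, with one axiom of size 1 per declaration; in a β-step it serves the
variables that are not replaced. -/
theorem mrel_typ_var_flat (Γ : Ctx V A) :
    MRel (fun q p => Typ (.var q.1) q.2 p) (flat Γ) (Γ, (flat Γ).card) := by
  induction Γ using Finsupp.induction_linear with
  | zero => simp
  | add Γ Δ h₁ h₂ => exact map_add (flat (A := A)) Γ Δ ▸ MRel.add_left.2 ⟨_, _, h₁, h₂, by simp⟩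
  | single x a =>
    rw [flat_single, MRel.map_left, Multiset.card_map]
    exact mrel_typ_var x a

variable [DecidableEq V] [Infinite V]

theorem Term.pick_notMem (x : V) (S : Finset V) : pick x S ∉ S := by
  unfold pick
  split
  · exact Classical.choose_spec (Infinite.exists_notMem_finset S)
  · assumption

/-- Substitution in a typing: each axiom for a free variable is replaced by a typing of the term
substituted for it. -/
theorem Typ.subst {t : Term V} {σ : V → Term V} {α : Ty A} {Γ Δ : Ctx V A} {n k : ℕ}
    (h : Typ t α (Γ, n)) (hσ : MRel (fun q p => Typ (σ q.1) q.2 p) (flat Γ) (Δ, k)) :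
    ∃ m, Typ (t.subst σ) α (Δ, m) ∧ m + (flat Γ).card = n + k := by
  induction t generalizing σ α Γ Δ n k with
  | var x =>
    cases h
    rw [flat_single, Multiset.map_singleton, MRel.singleton_left] at hσ
    exact ⟨k, hσ, by rw [flat_single, Multiset.card_map, Multiset.card_singleton, add_comm]⟩
  | lam x t ih =>
    obtain ⟨Γ, a, β, n, hx, h, rfl, hp⟩ := h
    cases hp
    rw [Term.subst]
    set z := Term.pick x ((t.fv.erase x).biUnion fun y => (σ y).fv)
    have hne : ∀ q ∈ flat Γ, q.1 ≠ x := fun q hq e => ne_zero_of_mem_flat hq (e ▸ hx)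
    have hΔ : Δ z = 0 := by
      refine hσ.apply_fst_eq_zero fun q hq p hp => hp.eq_zero_of_notMem_fv fun hzq => ?_
      refine Term.pick_notMem x ((t.fv.erase x).biUnion fun y => (σ y).fv) ?_
      refine Finset.mem_biUnion.2 ⟨q.1, Finset.mem_erase.2 ⟨hne q hq, ?_⟩, hzq⟩
      by_contra hq'
      have := h.eq_zero_of_notMem_fv hq'
      rw [Finsupp.add_apply, add_eq_zero] at this
      exact ne_zero_of_mem_flat hq this.1
    -- The bound variable is sent to `z`: each of its axioms is replaced by an axiom, so the added
    -- `a.card` cancels in the size equation.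
    have hσ' : MRel (fun q p => Typ (Function.update σ x (.var z) q.1) q.2 p)
        (flat (Γ + Finsupp.single x a)) (Δ + Finsupp.single z a, k + a.card) := by
      rw [map_add, MRel.add_left]
      refine ⟨_, _, hσ.mono fun q hq p hp => ?_, ?_, (Prod.mk_add_mk _ _ _ _).symm⟩
      · rwa [Function.update_of_ne (hne q hq)]
      · rw [flat_single, MRel.map_left]
        simpa using mrel_typ_var z a
    obtain ⟨m, hm, e⟩ := ih h hσ'
    refine ⟨m + 1, ⟨Δ, a, β, m, hΔ, hm, rfl, rfl⟩, ?_⟩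
    rw [map_add, Multiset.card_add, flat_single, Multiset.card_map] at e
    omega
  | app t s iht ihs =>
    obtain ⟨a, ⟨Γ₀, n₀⟩, ⟨Γ₁, n₁⟩, h₀, h₁, hp⟩ := h
    cases hp
    simp only [Prod.mk_add_mk, add_zero] at hσ ⊢
    rw [map_add] at hσ ⊢
    obtain ⟨⟨Δ₀, k₀⟩, ⟨Δ₁, k₁⟩, hσ₀, hσ₁, e⟩ := MRel.add_left.1 hσ
    cases e
    obtain ⟨m₀, hm₀, e₀⟩ := iht h₀ hσ₀
    -- The induction hypothesis for `s`, summed over the types in `a`.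
    obtain ⟨m₁, hm₁, e₁⟩ : ∃ m, MRel (Typ (s.subst σ)) a (Δ₁, m) ∧
        m + (flat Γ₁).card = n₁ + k₁ := by
      clear h₀ hσ hσ₀ hm₀ e₀ iht
      induction a using Multiset.induction generalizing Γ₁ n₁ Δ₁ k₁ with
      | empty =>
        cases MRel.zero_left.1 h₁
        cases MRel.zero_left.1 ((map_zero (flat (V := V) (A := A))) ▸ hσ₁)
        exact ⟨0, MRel.zero_left.2 rfl, by simp⟩
      | cons γ a ih =>
        obtain ⟨⟨Γ, n⟩, ⟨Γ', n'⟩, hΓ, hΓ', e⟩ := MRel.cons_left.1 h₁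
        cases e
        rw [map_add] at hσ₁
        obtain ⟨⟨Δ, k⟩, ⟨Δ', k'⟩, hΔ, hΔ', e⟩ := MRel.add_left.1 hσ₁
        cases e
        obtain ⟨m, hm, e⟩ := ihs hΓ hΔ
        obtain ⟨m', hm', e'⟩ := ih _ _ hΓ' _ _ hΔ'
        refine ⟨m + m', MRel.cons_left.2 ⟨_, _, hm, hm', rfl⟩, ?_⟩
        simp only [map_add, Multiset.card_add]
        omega
    refine ⟨m₀ + m₁ + 1, ⟨a, _, _, hm₀, hm₁, ?_⟩, ?_⟩
    · simp
    · rw [Multiset.card_add]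
      omega

/-- Weak head reduction decreases the size of typings. -/
theorem Typ.weakHeadRed {t t' : Term V} (hr : Term.WeakHeadRed t t') {α : Ty A} {Γ : Ctx V A}
    {n : ℕ} (h : Typ t α (Γ, n)) : ∃ m < n, Typ t' α (Γ, m) := by
  induction hr generalizing α Γ n with
  | beta x t s =>
    obtain ⟨a, _, ⟨Γ₁, n₁⟩, ⟨Γ₀, b, β, n₀, hx, h₀, e, rfl⟩, h₁, hp⟩ := h
    cases hp
    obtain ⟨rfl, rfl⟩ := Ty.arrow_inj e
    -- Axioms for `Γ₀` are replaced by axioms, and those for `x` by the typings of `s`. Hence `m +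
    -- a.card = n₀ + n₁`, while the redex has size `n₀ + n₁ + 2`.
    have hσ : MRel (fun q p => Typ (Function.update Term.var x s q.1) q.2 p)
        (flat (Γ₀ + Finsupp.single x a)) (Γ₀ + Γ₁, (flat Γ₀).card + n₁) := by
      rw [map_add, MRel.add_left]
      refine ⟨_, _, (mrel_typ_var_flat Γ₀).mono fun q hq p hp => ?_, ?_, (Prod.mk_add_mk _ _ _ _).symm⟩
      · rwa [Function.update_of_ne fun e : q.1 = x => ne_zero_of_mem_flat hq (e ▸ hx)]
      · rw [flat_single, MRel.map_left]
        simpa using h₁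
    obtain ⟨m, hm, e⟩ := h₀.subst hσ
    refine ⟨m, ?_, by simpa [Term.subst1] using hm⟩
    rw [map_add, Multiset.card_add] at e
    change m < n₀ + 1 + n₁ + 1
    omega
  | app s _ ih =>
    obtain ⟨a, ⟨Γ₀, n₀⟩, ⟨Γ₁, n₁⟩, h₀, h₁, hp⟩ := h
    cases hp
    obtain ⟨m, hm, h⟩ := ih h₀
    refine ⟨m + n₁ + 1, ?_, a, _, _, h, h₁, by simp⟩
    change m + n₁ + 1 < n₀ + n₁ + 1
    omega

/-- Head reduction decreases the size of typings. -/
theorem Typ.headRed {t t' : Term V} (hr : Term.HeadRed t t') {α : Ty A} {Γ : Ctx V A}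
    {n : ℕ} (h : Typ t α (Γ, n)) : ∃ m < n, Typ t' α (Γ, m) := by
  induction hr generalizing α Γ n with
  | weak hr => exact h.weakHeadRed hr
  | lam x _ ih =>
    obtain ⟨Γ, a, β, n, hx, h, rfl, hp⟩ := h
    cases hp
    obtain ⟨m, hm, h⟩ := ih h
    exact ⟨m + 1, by omega, Γ, a, β, m, hx, h, rfl, rfl⟩

theorem Term.isNeutral_or_weakHeadRed (t : Term V) :
    t.IsNeutral ∨ (∃ t', WeakHeadRed t t') ∨ ∃ x s, t = lam x s := by
  induction t with
  | var x => exact .inl (.var x)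
  | lam x t => exact .inr (.inr ⟨x, t, rfl⟩)
  | app t s iht =>
    rcases iht with h | ⟨t', h⟩ | ⟨x, u, rfl⟩
    · exact .inl (.app s h)
    · exact .inr (.inl ⟨_, .app s h⟩)
    · exact .inr (.inl ⟨_, .beta x u s⟩)

/-- Head reduction can only stop at a head normal form, so termination of head reduction suffices
for head normalizability. -/
theorem Term.isHNF_or_headRed (t : Term V) : t.IsHNF ∨ ∃ t', HeadRed t t' := by
  induction t with
  | lam x t ih =>
    rcases ih with h | ⟨t', h⟩
    · exact .inl (.lam x h)
    · exact .inr ⟨_, .lam x h⟩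
  | _ =>
    rcases isNeutral_or_weakHeadRed (V := V) _ with h | ⟨t', h⟩ | ⟨x, u, h⟩
    · exact .inl (.neutral h)
    · exact .inr ⟨_, .weak h⟩
    · cases h

/-- Typable terms are head normalizable. -/
theorem Typ.headNormalizable {t : Term V} {α : Ty A} {Γ : Ctx V A} {n : ℕ}
    (h : Typ t α (Γ, n)) : t.HeadNormalizable := by
  induction n using Nat.strong_induction_on generalizing t with
  | _ n ih =>
    rcases t.isHNF_or_headRed with ht | ⟨t', ht⟩
    · exact ⟨t, .refl, ht⟩
    · obtain ⟨m, hm, h'⟩ := h.headRed ht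
      obtain ⟨u, hu, hu'⟩ := ih m hm h'
      exact ⟨u, hu.head ht, hu'⟩

end SubjectReduction

/-! ### Number of steps and least size -/

section Main

variable {V : Type u} {A : Type v} [DecidableEq V] [Infinite V]

omit [DecidableEq V] [Infinite V] in
theorem minSize_le {t : Term V} {α : Ty A} {Γ : Ctx V A} {n : ℕ} (h : Typ t α (Γ, n)) :
    minSize A t ≤ n := by
  obtain ⟨d, rfl⟩ := h.exists_derivation
  exact iInf_le_of_le Γ (iInf_le_of_le α (iInf_le _ d))

/-- A derivation bounds the number of steps, and a halting run yields a derivation of the same size.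
Comparing the infima term by term also covers the value `∞`, where both families are empty. -/
theorem steps_init_eq_minSize [Nonempty A] {t u : Term V} (h : Term.AlphaEq t u)
    (hu : (State.init u).RespectsConvention) :
    (Conf.state (State.init u)).steps = minSize A t := by
  refine le_antisymm (le_iInf fun Γ => le_iInf fun α => le_iInf fun d => ?_)
    (le_iInf fun n => le_iInf fun hn => ?_)
  · obtain ⟨m, hm, hm'⟩ :=
      (State.typ_init.2 ⟨Γ, α, d.typ.alphaEq h⟩ : (State.init u).Typ A _).exists_haltsIn hu
    exact (iInf₂_le m hm').trans (by exact_mod_cast hm)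
  · obtain ⟨Γ, α, h'⟩ := State.typ_init.1 (State.typ_of_haltsIn (A := A) hu hn)
    exact minSize_le (h'.alphaEq h.symm)

theorem minSize_eq_top {t : Term V} (h : ¬ t.HeadNormalizable) : minSize A t = ⊤ := by
  simp only [minSize, iInf_eq_top]
  exact fun Γ α d => absurd d.typ.headNormalizable h

omit [DecidableEq V] [Infinite V] in
theorem State.respectsConvention_init {t : Term V} (h : t.RespectsConvention) :
    (State.init t).RespectsConvention :=
  ⟨⟨h, fun x hx => absurd hx (Finset.notMem_empty x),
    fun x => absurd x.2 (Finset.notMem_empty x.1)⟩, fun _ hc => absurd hc List.not_mem_nil⟩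

end Main

end HeadKrivine

theorem mainTheorem2 {V : Type*} [DecidableEq V] [Infinite V] {A : Type*} [Nonempty A]
    (t : Term V) :
    (∃ u, Term.AlphaEq t u ∧ (State.init u).RespectsConvention) ∧
    (∀ u, Term.AlphaEq t u → (State.init u).RespectsConvention →
      (Conf.state (State.init u)).steps = minSize A t) ∧
    (¬ t.HeadNormalizable →
      minSize A t = ⊤ ∧
      ∀ u, Term.AlphaEq t u → (State.init u).RespectsConvention →
        (Conf.state (State.init u)).steps = ⊤) := by
  refine ⟨?_, fun u hu h => steps_init_eq_minSize hu h, fun ht =>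
    ⟨minSize_eq_top ht, fun u hu h => ?_⟩⟩
  · obtain ⟨u, hu, h, -⟩ := t.exists_alphaEq_respectsConvention ∅
    exact ⟨u, hu, State.respectsConvention_init h⟩
  · rw [steps_init_eq_minSize (A := A) hu h, minSize_eq_top ht]
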